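/- Let $m,n\ge 1$, $q=\min\{m,n\}$, and let $\{f_j\}_{j=1}^n$ be a frame for a subspace $\mathcal K\subseteq\mathbb C^m$ (that is, $\operatorname{span}\{f_1,\dots,f_n\}=\mathcal K$). Let $F\in\mathbb C^{m\times n}$ be its synthesis matrix (the matrix with columns $f_1,\dots,f_n$), let $r=\operatorname{rank}F$, and let $s_1(F)\ge s_2(F)\ge\cdots\ge s_q(F)\ge 0$ be its singular values. A family $\{u_j\}_{j=1}^n$ in $\mathbb C^m$ is a Parseval frame if $\|x\|^2=\sum_{j=1}^n|\langle x,u_j\rangle|^2$ for every $x$ in the span of $u_1,\dots,u_n$. The excess of a family $\{u_j\}_{j=1}^n$ is the largest cardinality of a set $I\subseteq\{1,\dots,n\}$ such that $\{u_j\}_{j\notin I}$ has the same span as the whole family. For $1\le k\le q$ let $\mathcal J_{n-k}$ be the set of all Parseval frames $\{u_j\}_{j=1}^n$ in $\mathbb C^m$ (for any subspace) with excess $n-k$. A frame $\{u_j\}_{j=1}^n\in\mathcal J_{n-k}$ is called a symmetric approximation of $\{f_j\}_{j=1}^n$ in $\mathcal J_{n-k}$ if $$\sum_{j=1}^n\|f_j-u_j\|^2\le\sum_{j=1}^n\|f_j-x_j\|^2\qquad\text{for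 all }\{x_j\}_{j=1}^n\in\mathcal J_{n-k}.$$ Let $1\le k\le q$. Then a family $\{u_j\}_{j=1}^n$ is a symmetric approximation of $\{f_j\}_{j=1}^n$ in $\mathcal J_{n-k}$ if and only if there are unitary matrices $V\in\mathbb C^{m\times m}$ and $W\in\mathbb C^{n\times n}$ such that $F=V\Sigma W^*$ is a singular value decomposition ($\Sigma\in\mathbb C^{m\times n}$ having $s_1(F),\dots,s_q(F)$, in this order, on its diagonal and zeros elsewhere) and $$u_j=V\begin{bmatrix}I_k&0\\0&0_{m-k,n-k}\end{bmatrix}W^*e_j,\qquad j=1,\dots,n,$$ where $\{e_j\}_{j=1}^n$ is the standard basis of $\mathbb C^n$. Moreover: 1. if $k<r$, there is exactly one symmetric approximation of $\{f_j\}_{j=1}^n$ in $\mathcal J_{n-k}$ if and only if $s_k(F)\ne s_{k+1}(F)$; 2. if $k=r$, there is exactly one, and it is the canonical Parseval frame $u_j=Ue_j$ associated to $\{f_j\}_{j=1}^n$, where $U$ is the partial isometry (norm preserving on $(\ker U)^\perp$) determined by $F=U(F^*F)^{1/2}$ and $\ker U=\ker F$; 3. if $r<k\le q$, there are infinitely many.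 -/

import Mathlib

open scoped Matrix MatrixOrder

noncomputable section

namespace FrameApprox

/-- The linear map `ℂⁿ → ℂᵐ` (Euclidean norms) given by an `m × n` matrix. -/
abbrev toLin {m n : ℕ} (X : Matrix (Fin m) (Fin n) ℂ) :
    EuclideanSpace ℂ (Fin n) →ₗ[ℂ] EuclideanSpace ℂ (Fin m) :=
  Matrix.toEuclideanLin X

/-! ### Frames -/

/-- `f` is a finite frame for the subspace `K`: its vectors span `K`. -/
def IsFrameFor {m n : ℕ} (f : Fin n → EuclideanSpace ℂ (Fin m))
    (K : Submodule ℂ (EuclideanSpace ℂ (Fin m))) : Prop :=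
  Submodule.span ℂ (Set.range f) = K

/-- `u` is a Parseval frame for `K`. -/
def IsParsevalFrameFor {m n : ℕ} (u : Fin n → EuclideanSpace ℂ (Fin m))
    (K : Submodule ℂ (EuclideanSpace ℂ (Fin m))) : Prop :=
  IsFrameFor u K ∧ ∀ x ∈ K, ‖x‖ ^ 2 = ∑ j, ‖inner ℂ (u j) x‖ ^ 2

/-- `u` is an `n`-Parseval frame, i.e. a Parseval frame for some subspace of `ℂᵐ`. -/
def IsParsevalFrame {m n : ℕ} (u : Fin n → EuclideanSpace ℂ (Fin m)) : Prop :=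
  ∃ K, IsParsevalFrameFor u K

/-- The excess of a finite family: the largest number of indices that can be deleted without
changing the span. The set is nonempty (take `I = ∅`) and bounded by `n`, so this is a maximum. -/
def excess {m n : ℕ} (u : Fin n → EuclideanSpace ℂ (Fin m)) : ℕ :=
  sSup {c : ℕ | ∃ I : Finset (Fin n), I.card = c ∧
    Submodule.span ℂ (u '' {j | j ∉ I}) = Submodule.span ℂ (Set.range u)}

/-- The family of `n`-Parseval frames in `ℂᵐ` with excess `e`. -/
def parsevalFramesOfExcess (m n e : ℕ) : Set (Fin n → EuclideanSpace ℂ (Fin m)) :=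
  {u | IsParsevalFrame u ∧ excess u = e}

/-- `u` is a symmetric approximation of `f` in the family `J`. -/
def IsSymmetricApprox {m n : ℕ} (f : Fin n → EuclideanSpace ℂ (Fin m))
    (J : Set (Fin n → EuclideanSpace ℂ (Fin m))) (u : Fin n → EuclideanSpace ℂ (Fin m)) : Prop :=
  u ∈ J ∧ ∀ x ∈ J, ∑ j, ‖f j - u j‖ ^ 2 ≤ ∑ j, ‖f j - x j‖ ^ 2

/-- The synthesis matrix: its columns are the vectors of the family. -/
def synthesisMatrix {m n : ℕ} (f : Fin n → EuclideanSpace ℂ (Fin m)) :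
    Matrix (Fin m) (Fin n) ℂ :=
  Matrix.of fun i j => f j i

/-- The family `X e₁, …, X eₙ` of the images of the standard basis vectors. -/
def columnFamily {m n : ℕ} (X : Matrix (Fin m) (Fin n) ℂ) : Fin n → EuclideanSpace ℂ (Fin m) :=
  fun j => toLin X (EuclideanSpace.single j 1)

/-! ### Singular values and singular value decompositions -/

/-- The singular values in nonincreasing order, with the index starting at `1` (the value at `0`
is not used), extended by `0` beyond the number of columns. -/
def singularValue {m n : ℕ} (F : Matrix (Fin m) (Fin n) ℂ) (j : ℕ) : ℝ :=
  (toLin F).singularValues (j - 1)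

/-- The `m × n` matrix with the singular values of `F` on its diagonal. -/
def sigmaMatrix {m n : ℕ} (F : Matrix (Fin m) (Fin n) ℂ) : Matrix (Fin m) (Fin n) ℂ :=
  Matrix.of fun i j => if (i : ℕ) = (j : ℕ) then ((singularValue F ((i : ℕ) + 1) : ℝ) : ℂ) else 0

/-- `F = V Σ W*` is a singular value decomposition of `F`. -/
def IsSVD {m n : ℕ} (F : Matrix (Fin m) (Fin n) ℂ) (V : Matrix (Fin m) (Fin m) ℂ)
    (W : Matrix (Fin n) (Fin n) ℂ) : Prop :=
  V ∈ Matrix.unitaryGroup (Fin m) ℂ ∧ W ∈ Matrix.unitaryGroup (Fin n) ℂ ∧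
    F = V * sigmaMatrix F * Wᴴ

/-- The `m × n` block matrix with `I_k` in the upper left corner and zeros elsewhere. -/
def blockId (m n k : ℕ) : Matrix (Fin m) (Fin n) ℂ :=
  Matrix.of fun i j => if (i : ℕ) = (j : ℕ) ∧ (i : ℕ) < k then 1 else 0

/-! ### The canonical Parseval frame -/

/-- `X` is a partial isometry: it preserves the norm on the orthogonal complement of its kernel. -/
def IsPartialIsometry {m n : ℕ} (X : Matrix (Fin m) (Fin n) ℂ) : Prop :=
  ∀ x ∈ (LinearMap.ker (toLin X))ᗮ, ‖toLin X x‖ = ‖x‖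

/-- `|F| = (F* F)^{1/2}`. -/
def matrixAbs {m n : ℕ} (F : Matrix (Fin m) (Fin n) ℂ) : Matrix (Fin n) (Fin n) ℂ :=
  CFC.sqrt (Fᴴ * F)

/-- `F = U |F|` is the canonical polar decomposition of `F`. -/
def IsCanonicalPolar {m n : ℕ} (F U : Matrix (Fin m) (Fin n) ℂ) : Prop :=
  IsPartialIsometry U ∧ LinearMap.ker (toLin U) = LinearMap.ker (toLin F) ∧ F = U * matrixAbs F

/-- `u` is the canonical Parseval frame associated to `f`: `u_j = U e_j`, where `U` is the partial
isometry of the canonical polar decomposition of the synthesis matrix of `f`. -/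
def IsCanonicalParsevalFrame {m n : ℕ} (f u : Fin n → EuclideanSpace ℂ (Fin m)) : Prop :=
  ∃ U, IsCanonicalPolar (synthesisMatrix f) U ∧ u = columnFamily U

end FrameApprox

end

noncomputable section

namespace FrameApprox

open Finset

/-! Under synthesis matrices, the Parseval frames of excess `n - k` are exactly the partial
isometries of rank `k`. All of these have squared Frobenius norm `k`, so minimizing the distance to
`F` means maximizing the real Frobenius pairing with `F` (`IsMaximizer`).

The maximum is the sum of the first `k` singular values, attained by truncating an SVD. For the
upper bound, pass to coordinates where `F` is diagonal. The real diagonal entries of a rank-`k`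
partial isometry are then dominated by weights in `[0, 1]` of total at most `k`, and such weights
pair best with a nonincreasing sequence when concentrated on its first `k` terms.

Conversely, let `X` be a maximizer and let `B` be the truncation of an SVD of `F + X`. Combining the
optimality of `B` for `F + X` with that of `X` for `F` gives `k ≤ ⟨B, X⟩`, so `B = X`. Then `F = (F
+ X) - X` is diagonal in the same bases, and comparing `X` with a sign flip and with swaps of
directions shows that its diagonal is nonnegative and correctly ordered.

If `s_k > s_{k+1}`, subtracting the gap times the truncation leaves a sorted diagonal, and the upper
bound for that remainder forces uniqueness. If `s_k = s_{k+1}` and `k < r`, a swap gives a second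
maximizer; if `s_k = 0`, a phase on the `k`-th direction gives infinitely many. For `k = r` the
truncation is the polar factor. -/

/-- The `m × n` matrix with `a 0, a 1, …` on its diagonal. -/
def rectDiagonal (m n : ℕ) (a : ℕ → ℂ) : Matrix (Fin m) (Fin n) ℂ :=
  Matrix.of fun i j => if (i : ℕ) = (j : ℕ) then a i else 0

/-- The diagonal entries of a rectangular matrix, extended by zero. -/
def diagEntry {m n : ℕ} (B : Matrix (Fin m) (Fin n) ℂ) (i : ℕ) : ℂ :=
  if h : i < m ∧ i < n then B ⟨i, h.1⟩ ⟨i, h.2⟩ else 0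

/-- `Z` is a partial isometry of rank `k`. -/
def IsRankPartialIsometry {m n : ℕ} (k : ℕ) (Z : Matrix (Fin m) (Fin n) ℂ) : Prop :=
  Z * Zᴴ * Z = Z ∧ (Zᴴ * Z).trace = k

/-- The real part of the Frobenius inner product. -/
def frobRe {m n : ℕ} (A B : Matrix (Fin m) (Fin n) ℂ) : ℝ := (Aᴴ * B).trace.re

variable {m n k : ℕ}

/-! ### Rectangular diagonal matrices and the Frobenius pairing -/

lemma rectDiagonal_conjTranspose (a : ℕ → ℂ) :
    (rectDiagonal m n a)ᴴ = rectDiagonal n m (fun i => star (a i)) := by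
  ext i j
  simp only [rectDiagonal, Matrix.conjTranspose_apply, Matrix.of_apply]
  by_cases h : (i : ℕ) = j
  · simp [h]
  · simp [h, Ne.symm h]

lemma rectDiagonal_mul (a b : ℕ → ℂ) (l : ℕ) :
    rectDiagonal m n a * rectDiagonal n l b =
      rectDiagonal m l (fun i => if i < n then a i * b i else 0) := by
  ext i j
  simp only [rectDiagonal, Matrix.mul_apply, Matrix.of_apply]
  by_cases h : (i : ℕ) < n
  · rw [Finset.sum_eq_single ⟨i, h⟩]
    · by_cases hij : (i : ℕ) = j
      · have hj : (j : ℕ) < n := hij ▸ h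
        simp [hij, hj]
      · simp [hij]
    · intro x _ hx
      rw [if_neg (fun h' => hx (Fin.ext h'.symm)), zero_mul]
    · simp
  · rw [Finset.sum_eq_zero]
    · simp [h]
    · intro x _
      rw [if_neg (by omega), zero_mul]

lemma rectDiagonal_congr {a b : ℕ → ℂ} (h : ∀ i < min m n, a i = b i) :
    rectDiagonal m n a = rectDiagonal m n b := by
  ext i j
  simp only [rectDiagonal, Matrix.of_apply]
  split_ifs with hij
  · exact h i (by omega)
  · rfl

lemma rectDiagonal_apply_self (a : ℕ → ℂ) {i : ℕ} (hi : i < min m n) :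
    diagEntry (rectDiagonal m n a) i = a i := by
  simp [diagEntry, rectDiagonal, lt_min_iff.1 hi]

lemma rectDiagonal_add (a b : ℕ → ℂ) :
    rectDiagonal m n a + rectDiagonal m n b = rectDiagonal m n (fun i => a i + b i) := by
  ext i j
  simp only [rectDiagonal, Matrix.of_apply, Matrix.add_apply]
  split_ifs <;> simp

lemma trace_rectDiagonal_conjTranspose_mul (a : ℕ → ℂ) (B : Matrix (Fin m) (Fin n) ℂ) :
    ((rectDiagonal m n a)ᴴ * B).trace = ∑ i ∈ range (min m n), star (a i) * diagEntry B i := by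
  have h1 : ∀ j : Fin n, ((rectDiagonal m n a)ᴴ * B) j j = star (a j) * diagEntry B j := by
    intro j
    rw [rectDiagonal_conjTranspose, Matrix.mul_apply]
    simp only [rectDiagonal, Matrix.of_apply, diagEntry]
    by_cases h : (j : ℕ) < m
    · rw [Finset.sum_eq_single ⟨j, h⟩]
      · simp [h]
      · intro x _ hx
        rw [if_neg (fun h' => hx (Fin.ext h'.symm)), zero_mul]
      · simp
    · rw [Finset.sum_eq_zero]
      · simp [h]
      · intro x _
        rw [if_neg (by omega), zero_mul]
  simp only [Matrix.trace, Matrix.diag_apply, h1]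
  rw [← Finset.sum_range (fun i => star (a i) * diagEntry B i)]
  symm
  refine Finset.sum_subset (by simp) fun i hi hi' => ?_
  simp only [mem_range] at hi hi'
  rw [diagEntry, dif_neg (by omega), mul_zero]

lemma frobRe_comm (A B : Matrix (Fin m) (Fin n) ℂ) : frobRe A B = frobRe B A := by
  have h := Matrix.trace_conjTranspose (Aᴴ * B)
  rw [Matrix.conjTranspose_mul, Matrix.conjTranspose_conjTranspose] at h
  simp [frobRe, h]

lemma frobRe_add (A B C : Matrix (Fin m) (Fin n) ℂ) :
    frobRe A (B + C) = frobRe A B + frobRe A C := by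
  simp [frobRe, Matrix.mul_add]

lemma frobRe_sub_self (A B : Matrix (Fin m) (Fin n) ℂ) :
    frobRe (A - B) (A - B) = frobRe A A + frobRe B B - 2 * frobRe B A := by
  have h := frobRe_comm A B
  simp only [frobRe, Matrix.conjTranspose_sub, Matrix.sub_mul, Matrix.mul_sub, Matrix.trace_sub,
    Complex.sub_re] at *
  linarith

lemma frobRe_self (A : Matrix (Fin m) (Fin n) ℂ) :
    frobRe A A = ∑ j, ∑ i, ‖A i j‖ ^ 2 := by
  simp only [frobRe, Matrix.trace, Matrix.diag_apply, Matrix.mul_apply, Complex.re_sum,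
    Matrix.conjTranspose_apply]
  refine sum_congr rfl fun j _ => sum_congr rfl fun i _ => ?_
  have := Complex.conj_mul' (A i j)
  rw [Complex.star_def, this, ← Complex.ofReal_pow, Complex.ofReal_re]

lemma frobRe_self_nonneg (A : Matrix (Fin m) (Fin n) ℂ) : 0 ≤ frobRe A A := by
  rw [frobRe_self]; positivity

lemma eq_zero_of_frobRe_self_nonpos {A : Matrix (Fin m) (Fin n) ℂ} (h : frobRe A A ≤ 0) :
    A = 0 := by
  have h0 := le_antisymm h (frobRe_self_nonneg A)
  rw [frobRe_self, Finset.sum_eq_zero_iff_of_nonneg (fun _ _ => by positivity)] at h0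
  ext i j
  have h1 := h0 j (mem_univ _)
  rw [Finset.sum_eq_zero_iff_of_nonneg (fun _ _ => by positivity)] at h1
  simpa using h1 i (mem_univ _)

lemma frobRe_mul_unitary {V : Matrix (Fin m) (Fin m) ℂ} {W : Matrix (Fin n) (Fin n) ℂ}
    (hV : V ∈ Matrix.unitaryGroup (Fin m) ℂ) (hW : W ∈ Matrix.unitaryGroup (Fin n) ℂ)
    (A B : Matrix (Fin m) (Fin n) ℂ) : frobRe (V * A * Wᴴ) (V * B * Wᴴ) = frobRe A B := by
  have hV' : Vᴴ * V = 1 := Matrix.mem_unitaryGroup_iff'.1 hV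
  have hW' : Wᴴ * W = 1 := Matrix.mem_unitaryGroup_iff'.1 hW
  have : (V * A * Wᴴ)ᴴ * (V * B * Wᴴ) = W * (Aᴴ * B * Wᴴ) := by
    simp only [Matrix.conjTranspose_mul, Matrix.conjTranspose_conjTranspose, Matrix.mul_assoc]
    rw [← Matrix.mul_assoc Vᴴ V, hV', Matrix.one_mul]
  rw [frobRe, frobRe, this, Matrix.trace_mul_comm, Matrix.mul_assoc, hW', Matrix.mul_one]

/-! ### Partial isometries of rank `k` and their diagonals -/

lemma IsRankPartialIsometry.mul_unitary {Z : Matrix (Fin m) (Fin n) ℂ}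
    (h : IsRankPartialIsometry k Z) {V : Matrix (Fin m) (Fin m) ℂ} {W : Matrix (Fin n) (Fin n) ℂ}
    (hV : V ∈ Matrix.unitaryGroup (Fin m) ℂ) (hW : W ∈ Matrix.unitaryGroup (Fin n) ℂ) :
    IsRankPartialIsometry k (V * Z * Wᴴ) := by
  have hV' : Vᴴ * V = 1 := Matrix.mem_unitaryGroup_iff'.1 hV
  have hW' : Wᴴ * W = 1 := Matrix.mem_unitaryGroup_iff'.1 hW
  have e : (V * Z * Wᴴ)ᴴ * (V * Z * Wᴴ) = W * (Zᴴ * Z * Wᴴ) := by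
    simp only [Matrix.conjTranspose_mul, Matrix.conjTranspose_conjTranspose, Matrix.mul_assoc]
    rw [← Matrix.mul_assoc Vᴴ V, hV', Matrix.one_mul]
  refine ⟨?_, ?_⟩
  · rw [Matrix.mul_assoc, e, ← Matrix.mul_assoc, Matrix.mul_assoc (V * Z) Wᴴ W, hW',
      Matrix.mul_one, ← Matrix.mul_assoc, Matrix.mul_assoc V, ← Matrix.mul_assoc Z, h.1]
  · rw [e, Matrix.trace_mul_comm, Matrix.mul_assoc, hW', Matrix.mul_one, h.2]

lemma IsRankPartialIsometry.frobRe_self {Z : Matrix (Fin m) (Fin n) ℂ}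
    (h : IsRankPartialIsometry k Z) : frobRe Z Z = k := by
  simp [frobRe, h.2]

lemma isRankPartialIsometry_rectDiagonal {a : ℕ → ℂ} (ha : ∀ i, a i * star (a i) * a i = a i)
    (hk : ∑ i ∈ range (min m n), star (a i) * a i = k) :
    IsRankPartialIsometry k (rectDiagonal m n a) := by
  refine ⟨?_, ?_⟩
  · rw [rectDiagonal_conjTranspose, rectDiagonal_mul, rectDiagonal_mul]
    refine rectDiagonal_congr fun i hi => ?_
    rw [lt_min_iff] at hi
    simp only [hi.1, hi.2, if_true, ha]
  · rw [trace_rectDiagonal_conjTranspose_mul, ← hk]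
    exact sum_congr rfl fun i hi => by rw [rectDiagonal_apply_self _ (mem_range.1 hi)]

lemma IsRankPartialIsometry.conjTranspose {Z : Matrix (Fin m) (Fin n) ℂ}
    (h : IsRankPartialIsometry k Z) : IsRankPartialIsometry k Zᴴ := by
  refine ⟨?_, ?_⟩
  · have := congrArg Matrix.conjTranspose h.1
    simpa [Matrix.conjTranspose_mul, Matrix.mul_assoc] using this
  · rw [Matrix.conjTranspose_conjTranspose, Matrix.trace_mul_comm, h.2]

/-- The squared norm of a column of a partial isometry is at most one. -/
lemma IsRankPartialIsometry.sum_sq_col_le_one {Z : Matrix (Fin m) (Fin n) ℂ}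
    (h : IsRankPartialIsometry k Z) (j : Fin n) : ∑ i, ‖Z i j‖ ^ 2 ≤ 1 := by
  have hP : (Zᴴ * Z)ᴴ * (Zᴴ * Z) = Zᴴ * Z := by
    rw [Matrix.conjTranspose_mul, Matrix.conjTranspose_conjTranspose, Matrix.mul_assoc,
      ← Matrix.mul_assoc Z, h.1]
  have gram : ∀ {p : ℕ} (A : Matrix (Fin p) (Fin n) ℂ),
      (Aᴴ * A) j j = ((∑ i, ‖A i j‖ ^ 2 : ℝ) : ℂ) := by
    intro p A
    simp only [Matrix.mul_apply, Matrix.conjTranspose_apply, Complex.star_def, Complex.conj_mul',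
      Complex.ofReal_sum, Complex.ofReal_pow]
  set x := ∑ i, ‖Z i j‖ ^ 2 with hx
  have h1 : x = ∑ i, ‖(Zᴴ * Z) i j‖ ^ 2 := by
    have := gram (Zᴴ * Z)
    rw [hP, gram Z] at this
    exact_mod_cast this
  -- The column norm `x` is both a diagonal entry of the projection `Zᴴ * Z` and the squared norm of
  -- that column of the projection, whence `x ^ 2 ≤ x`.
  have h2 : ‖(Zᴴ * Z) j j‖ ^ 2 ≤ ∑ i, ‖(Zᴴ * Z) i j‖ ^ 2 :=
    single_le_sum (f := fun i => ‖(Zᴴ * Z) i j‖ ^ 2) (fun _ _ => by positivity) (mem_univ j)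
  rw [← h1, gram Z, Complex.norm_real, Real.norm_eq_abs, sq_abs, ← hx] at h2
  nlinarith

/-- `Z = (Z * Zᴴ) * Z`, and row `i` of the projection `Z * Zᴴ` has the same norm as row `i` of `Z`;
then apply `2ab ≤ a² + b²` termwise. -/
lemma IsRankPartialIsometry.re_apply_le {Z : Matrix (Fin m) (Fin n) ℂ}
    (h : IsRankPartialIsometry k Z) (i : Fin m) (j : Fin n) :
    (Z i j).re ≤ ((∑ l, ‖Z l j‖ ^ 2) + ∑ l, ‖Z i l‖ ^ 2) / 2 := by
  have hQ : (Z * Zᴴ) * (Z * Zᴴ)ᴴ = Z * Zᴴ := by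
    rw [Matrix.conjTranspose_mul, Matrix.conjTranspose_conjTranspose, ← Matrix.mul_assoc,
      h.1]
  have gram : ∀ {p : ℕ} (A : Matrix (Fin m) (Fin p) ℂ),
      (A * Aᴴ) i i = ((∑ l, ‖A i l‖ ^ 2 : ℝ) : ℂ) := by
    intro p A
    simp only [Matrix.mul_apply, Matrix.conjTranspose_apply, Complex.star_def, Complex.mul_conj',
      Complex.ofReal_sum, Complex.ofReal_pow]
  have h1 : ∑ l, ‖Z i l‖ ^ 2 = ∑ l, ‖(Z * Zᴴ) i l‖ ^ 2 := by
    have := gram (Z * Zᴴ)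
    rw [hQ, gram Z] at this
    exact_mod_cast this
  have h2 : Z i j = ∑ l, (Z * Zᴴ) i l * Z l j := by
    rw [← Matrix.mul_apply, h.1]
  rw [h1, h2, Complex.re_sum, ← sum_add_distrib, sum_div]
  refine sum_le_sum fun l _ => ?_
  have h3 := Complex.re_le_norm ((Z * Zᴴ) i l * Z l j)
  rw [norm_mul] at h3
  nlinarith [sq_nonneg (‖(Z * Zᴴ) i l‖ - ‖Z l j‖)]

/-- Pairing the diagonal of a partial isometry of rank `k` with a nonincreasing nonnegative
sequence gives at most the sum of the first `k` terms. -/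
lemma IsRankPartialIsometry.sum_mul_re_diagEntry_le {Z : Matrix (Fin m) (Fin n) ℂ}
    (h : IsRankPartialIsometry k Z) (hk : k ≤ min m n) {s : ℕ → ℝ} (hs : Antitone s)
    (hs0 : ∀ i, 0 ≤ s i) :
    ∑ i ∈ range (min m n), s i * (diagEntry Z i).re ≤ ∑ i ∈ range k, s i := by
  set col : ℕ → ℝ := fun j => if hj : j < n then ∑ l, ‖Z l ⟨j, hj⟩‖ ^ 2 else 0 with hcol
  set row : ℕ → ℝ := fun i => if hi : i < m then ∑ l, ‖Z ⟨i, hi⟩ l‖ ^ 2 else 0 with hrow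
  set c : ℕ → ℝ := fun i => (col i + row i) / 2 with hc
  have hcol0 : ∀ i, 0 ≤ col i := fun i => by
    simp only [hcol]; split_ifs <;> positivity
  have hrow0 : ∀ i, 0 ≤ row i := fun i => by
    simp only [hrow]; split_ifs <;> positivity
  have hcol1 : ∀ i, col i ≤ 1 := fun i => by
    simp only [hcol]
    split_ifs
    · exact h.sum_sq_col_le_one _
    · exact zero_le_one
  have hrow1 : ∀ i, row i ≤ 1 := fun i => by
    simp only [hrow]
    split_ifs
    · simpa using h.conjTranspose.sum_sq_col_le_one ⟨i, by assumption⟩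
    · exact zero_le_one
  have hsum : ∑ i ∈ range (min m n), c i ≤ k := by
    have e1 : ∑ i ∈ range n, col i = k := by
      rw [Finset.sum_range, ← h.frobRe_self, FrameApprox.frobRe_self]
      simp [hcol]
    have e2 : ∑ i ∈ range m, row i = k := by
      rw [Finset.sum_range, ← h.conjTranspose.frobRe_self, FrameApprox.frobRe_self]
      simp [hrow]
    have e3 : ∑ i ∈ range (min m n), col i ≤ ∑ i ∈ range n, col i :=
      sum_le_sum_of_subset_of_nonneg (by simp) fun i _ _ => hcol0 i
    have e4 : ∑ i ∈ range (min m n), row i ≤ ∑ i ∈ range m, row i :=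
      sum_le_sum_of_subset_of_nonneg (by simp) fun i _ _ => hrow0 i
    rw [← sum_div, sum_add_distrib]
    linarith
  have hle : ∀ i ∈ range (min m n), s i * (diagEntry Z i).re ≤ s i * c i := fun i hi => by
    have hi' := lt_min_iff.1 (mem_range.1 hi)
    refine mul_le_mul_of_nonneg_left ?_ (hs0 i)
    simpa [hc, hcol, hrow, diagEntry, hi'] using h.re_apply_le ⟨i, hi'.1⟩ ⟨i, hi'.2⟩
  set d : ℕ → ℝ := fun i => if i < k then 1 else 0 with hd
  have hind : ∀ t : ℕ → ℝ, ∑ i ∈ range (min m n), t i * d i = ∑ i ∈ range k, t i := fun t => by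
    simp only [hd, mul_ite, mul_one, mul_zero]
    rw [← sum_filter]
    congr 1
    ext i
    simp only [mem_filter, mem_range]
    omega
  -- With threshold `s (k - 1)`, both factors change sign at `k`. For `k = 0` the threshold is `s
  -- 0`, and only the second case occurs.
  have hterm : ∑ i ∈ range (min m n), (s i - s (k - 1)) * (c i - d i) ≤ 0 :=
    sum_nonpos fun i _ => by
      have hc0 : 0 ≤ c i := by simp only [hc]; linarith [hcol0 i, hrow0 i]
      have hc1 : c i ≤ 1 := by simp only [hc]; linarith [hcol1 i, hrow1 i]
      by_cases hik : i < k
      · simp only [hd, hik, if_true]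
        exact mul_nonpos_of_nonneg_of_nonpos (sub_nonneg.2 (hs (by omega))) (by linarith)
      · simp only [hd, hik, if_false]
        exact mul_nonpos_of_nonpos_of_nonneg (sub_nonpos.2 (hs (by omega))) (by linarith)
  have hexp : ∑ i ∈ range (min m n), (s i - s (k - 1)) * (c i - d i) =
      ∑ i ∈ range (min m n), s i * c i - ∑ i ∈ range k, s i
        - s (k - 1) * (∑ i ∈ range (min m n), c i - k) := by
    have e := hind (fun _ => 1)
    simp only [one_mul, sum_const, card_range, nsmul_eq_mul, mul_one] at e
    rw [← hind s, ← e, ← sum_sub_distrib, ← sum_sub_distrib, mul_sum, ← sum_sub_distrib]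
    exact sum_congr rfl fun i _ => by ring
  have := mul_nonneg (hs0 (k - 1)) (sub_nonneg.2 hsum)
  have := sum_le_sum hle
  linarith

/-! ### Parseval frames as partial isometries -/

lemma toLin_mul_apply {l : ℕ} (A : Matrix (Fin l) (Fin m) ℂ) (B : Matrix (Fin m) (Fin n) ℂ)
    (x : EuclideanSpace ℂ (Fin n)) : toLin (A * B) x = toLin A (toLin B x) := by
  rw [toLin, Matrix.toLpLin_mul 2 2 2, LinearMap.comp_apply]

lemma inner_toLin_right (A : Matrix (Fin m) (Fin n) ℂ) (x : EuclideanSpace ℂ (Fin m))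
    (y : EuclideanSpace ℂ (Fin n)) : inner ℂ x (toLin A y) = inner ℂ (toLin Aᴴ x) y := by
  rw [toLin, toLin, Matrix.toEuclideanLin_conjTranspose_eq_adjoint, LinearMap.adjoint_inner_left]

lemma norm_toLin_sq (A : Matrix (Fin m) (Fin n) ℂ) (x : EuclideanSpace ℂ (Fin n)) :
    ((‖toLin A x‖ ^ 2 : ℝ) : ℂ) = inner ℂ (toLin (Aᴴ * A) x) x := by
  rw [toLin_mul_apply, ← inner_toLin_right, inner_self_eq_norm_sq_to_K]
  simp

@[simp]
lemma columnFamily_apply (X : Matrix (Fin m) (Fin n) ℂ) (i : Fin m) (j : Fin n) :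
    columnFamily X j i = X i j := by
  simp [columnFamily, toLin, Matrix.toLpLin_apply]

@[simp]
lemma synthesisMatrix_columnFamily (X : Matrix (Fin m) (Fin n) ℂ) :
    synthesisMatrix (columnFamily X) = X := by
  ext i j
  simp [synthesisMatrix]

@[simp]
lemma columnFamily_synthesisMatrix (u : Fin n → EuclideanSpace ℂ (Fin m)) :
    columnFamily (synthesisMatrix u) = u := by
  ext j i
  simp [synthesisMatrix]

lemma columnFamily_injective :
    Function.Injective (columnFamily : Matrix (Fin m) (Fin n) ℂ → _) :=
  Function.LeftInverse.injective synthesisMatrix_columnFamily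

lemma span_range_columnFamily (X : Matrix (Fin m) (Fin n) ℂ) :
    Submodule.span ℂ (Set.range (columnFamily X)) = LinearMap.range (toLin X) := by
  have h := (EuclideanSpace.basisFun (Fin n) ℂ).toBasis.span_eq
  have h2 : Set.range (columnFamily X) =
      toLin X '' Set.range (EuclideanSpace.basisFun (Fin n) ℂ).toBasis := by
    rw [← Set.range_comp]
    congr 1
    ext j i
    simp [columnFamily]
  rw [h2, ← Submodule.map_span, h, LinearMap.range_eq_map]

lemma norm_toLin_conjTranspose_sq (X : Matrix (Fin m) (Fin n) ℂ)
    (x : EuclideanSpace ℂ (Fin m)) :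
    ∑ j, ‖inner ℂ (columnFamily X j) x‖ ^ 2 = ‖toLin Xᴴ x‖ ^ 2 := by
  rw [EuclideanSpace.norm_sq_eq]
  refine sum_congr rfl fun j _ => ?_
  congr 2
  simp only [PiLp.inner_apply, columnFamily_apply]
  simp [toLin, Matrix.toLpLin_apply, Matrix.mulVec, dotProduct, mul_comm]

-- On the range of `X` the Parseval identity reads `‖X y‖ = ‖Xᴴ X y‖`, which by complex polarization
-- says that `Xᴴ * X` is idempotent.
open scoped ComplexOrder in
lemma isParsevalFrame_columnFamily_iff (X : Matrix (Fin m) (Fin n) ℂ) :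
    IsParsevalFrame (columnFamily X) ↔ X * Xᴴ * X = X := by
  have h1 : IsParsevalFrame (columnFamily X) ↔
      ∀ y, ‖toLin X y‖ ^ 2 = ‖toLin (Xᴴ * X) y‖ ^ 2 := by
    simp only [IsParsevalFrame, IsParsevalFrameFor, IsFrameFor, exists_eq_left',
      span_range_columnFamily, norm_toLin_conjTranspose_sq]
    constructor
    · intro h y
      rw [toLin_mul_apply]
      exact h _ ⟨y, rfl⟩
    · rintro h _ ⟨y, rfl⟩
      rw [h y, toLin_mul_apply]
  rw [h1]
  constructor
  · intro h
    have h2 : Xᴴ * X - Xᴴ * X * (Xᴴ * X) = 0 := by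
      refine (Matrix.toEuclideanLin (𝕜 := ℂ)).injective ?_
      rw [map_zero, ← inner_map_self_eq_zero]
      intro y
      have e1 := norm_toLin_sq X y
      have e2 := norm_toLin_sq (Xᴴ * X) y
      rw [Matrix.conjTranspose_mul, Matrix.conjTranspose_conjTranspose, ← h y, e1] at e2
      rw [map_sub, LinearMap.sub_apply, inner_sub_left]
      exact sub_eq_zero.2 e2
    have h3 : Xᴴ * X * (Xᴴ * X) = Xᴴ * X := (sub_eq_zero.1 h2).symm
    rw [← sub_eq_zero, ← Matrix.conjTranspose_mul_self_eq_zero]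
    have h4 : (X * Xᴴ * X - X)ᴴ * (X * Xᴴ * X - X) =
        Xᴴ * X * (Xᴴ * X) * (Xᴴ * X) - Xᴴ * X * (Xᴴ * X) - (Xᴴ * X * (Xᴴ * X) - Xᴴ * X) := by
      simp only [Matrix.conjTranspose_sub, Matrix.conjTranspose_mul,
        Matrix.conjTranspose_conjTranspose, Matrix.sub_mul, Matrix.mul_sub, Matrix.mul_assoc]
    rw [h4, h3, h3, sub_self]
  · intro h y
    have e1 := norm_toLin_sq X y
    have e2 := norm_toLin_sq (Xᴴ * X) y
    rw [Matrix.conjTranspose_mul, Matrix.conjTranspose_conjTranspose, Matrix.mul_assoc,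
      ← Matrix.mul_assoc X, h, ← e1] at e2
    exact_mod_cast e2.symm

lemma finrank_range_toLin (X : Matrix (Fin m) (Fin n) ℂ) :
    Module.finrank ℂ (LinearMap.range (toLin X)) = X.rank := by
  rw [X.rank_eq_finrank_range_toLin (EuclideanSpace.basisFun (Fin m) ℂ).toBasis
    (EuclideanSpace.basisFun (Fin n) ℂ).toBasis, toLin,
    Matrix.toEuclideanLin_eq_toLin_orthonormal]

lemma trace_eq_rank_of_isIdempotentElem {A : Matrix (Fin n) (Fin n) ℂ} (h : IsIdempotentElem A) :
    A.trace = A.rank := by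
  have h1 : IsIdempotentElem (Matrix.toLin' A) := by
    rw [IsIdempotentElem, Module.End.mul_eq_comp, ← Matrix.toLin'_mul, h.eq]
  rw [← Matrix.trace_toLin'_eq, (LinearMap.IsIdempotentElem.isProj_range _ h1).trace, Matrix.rank]
  rfl

open scoped ComplexOrder in
lemma trace_conjTranspose_mul_self_eq_rank {X : Matrix (Fin m) (Fin n) ℂ}
    (h : X * Xᴴ * X = X) : (Xᴴ * X).trace = X.rank := by
  rw [trace_eq_rank_of_isIdempotentElem, Matrix.rank_conjTranspose_mul_self]
  rw [IsIdempotentElem, Matrix.mul_assoc, ← Matrix.mul_assoc X, h]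

/-- Deleting vectors from a family without changing its span leaves at least a basis. -/
lemma excess_eq (u : Fin n → EuclideanSpace ℂ (Fin m)) :
    excess u = n - Module.finrank ℂ (Submodule.span ℂ (Set.range u)) := by
  classical
  have hmem : n - Module.finrank ℂ (Submodule.span ℂ (Set.range u)) ∈
      {c : ℕ | ∃ I : Finset (Fin n), I.card = c ∧
        Submodule.span ℂ (u '' {j | j ∉ I}) = Submodule.span ℂ (Set.range u)} := by
    -- A linearly independent subfamily with full span; the indices outside it are deleted.
    obtain ⟨κ, a, ha, hspan, hli⟩ := exists_linearIndependent' ℂ u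
    have : Fintype κ := Fintype.ofInjective a ha
    refine ⟨(univ.image a)ᶜ, ?_, ?_⟩
    · rw [card_compl, Fintype.card_fin, card_image_of_injective _ ha, ← hspan,
        finrank_span_eq_card hli, card_univ]
    · rw [← hspan, Set.range_comp]
      congr 2
      ext j
      simp
  refine le_antisymm (csSup_le ⟨_, hmem⟩ ?_) (le_csSup ⟨n, ?_⟩ hmem)
  · rintro _ ⟨I, rfl, hI⟩
    have h1 : Module.finrank ℂ (Submodule.span ℂ (u '' {j | j ∉ I})) ≤ Iᶜ.card := by
      have e : u '' {j | j ∉ I} = ((Iᶜ.image u : Finset _) : Set _) := by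
        ext x; simp
      rw [e]
      exact (finrank_span_finset_le_card _).trans card_image_le
    rw [hI, card_compl, Fintype.card_fin] at h1
    have := card_le_univ I
    rw [Fintype.card_fin] at this
    omega
  · rintro _ ⟨I, rfl, -⟩
    simpa using card_le_univ I

/-- The excess is `n - rank`, and the rank is the trace of the projection `Xᴴ * X`. Truncated
subtraction loses nothing, as `k` and the rank are at most `n`. -/
lemma columnFamily_mem_parsevalFramesOfExcess_iff (hk : k ≤ n) (X : Matrix (Fin m) (Fin n) ℂ) :
    columnFamily X ∈ parsevalFramesOfExcess m n (n - k) ↔ IsRankPartialIsometry k X := by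
  have e : excess (columnFamily X) = n - X.rank := by
    rw [excess_eq, span_range_columnFamily, finrank_range_toLin]
  simp only [parsevalFramesOfExcess, Set.mem_ofPred_eq, isParsevalFrame_columnFamily_iff,
    IsRankPartialIsometry, e]
  refine and_congr_right fun h => ?_
  rw [trace_conjTranspose_mul_self_eq_rank h, Nat.cast_inj]
  have := X.rank_le_width
  omega

lemma sum_norm_sub_sq (F X : Matrix (Fin m) (Fin n) ℂ) :
    ∑ j, ‖columnFamily F j - columnFamily X j‖ ^ 2 = frobRe (F - X) (F - X) := by
  rw [frobRe_self]
  refine sum_congr rfl fun j _ => ?_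
  rw [EuclideanSpace.norm_sq_eq]
  simp

/-- `X` maximizes `frobRe · F` among the partial isometries of rank `k`. -/
def IsMaximizer (k : ℕ) (F X : Matrix (Fin m) (Fin n) ℂ) : Prop :=
  IsRankPartialIsometry k X ∧ ∀ Z, IsRankPartialIsometry k Z → frobRe Z F ≤ frobRe X F

/-- In the expansion of the squared distance only the cross term varies, both squared norms being
fixed. -/
lemma isSymmetricApprox_columnFamily_iff (hk : k ≤ n) (F X : Matrix (Fin m) (Fin n) ℂ) :
    IsSymmetricApprox (columnFamily F) (parsevalFramesOfExcess m n (n - k)) (columnFamily X) ↔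
      IsMaximizer k F X := by
  rw [IsSymmetricApprox, columnFamily_mem_parsevalFramesOfExcess_iff hk, IsMaximizer]
  refine and_congr_right fun hX => ?_
  have key : ∀ Z, IsRankPartialIsometry k Z →
      (∑ j, ‖columnFamily F j - columnFamily X j‖ ^ 2 ≤
        ∑ j, ‖columnFamily F j - columnFamily Z j‖ ^ 2 ↔ frobRe Z F ≤ frobRe X F) := by
    intro Z hZ
    rw [sum_norm_sub_sq, sum_norm_sub_sq, frobRe_sub_self, frobRe_sub_self, hX.frobRe_self,
      hZ.frobRe_self]
    constructor <;> intro h <;> linarith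
  constructor
  · intro h Z hZ
    exact (key Z hZ).1 (h _ ((columnFamily_mem_parsevalFramesOfExcess_iff hk Z).2 hZ))
  · intro h x hx
    rw [← columnFamily_synthesisMatrix x] at hx ⊢
    have hZ := (columnFamily_mem_parsevalFramesOfExcess_iff hk _).1 hx
    exact (key _ hZ).2 (h _ hZ)

/-! ### Existence and basic properties of the singular value decomposition -/

lemma of_orthonormalBasis_mem_unitaryGroup
    (b : OrthonormalBasis (Fin m) ℂ (EuclideanSpace ℂ (Fin m))) :
    (Matrix.of fun p i => b i p : Matrix (Fin m) (Fin m) ℂ) ∈ Matrix.unitaryGroup (Fin m) ℂ := by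
  rw [Matrix.mem_unitaryGroup_iff']
  ext i j
  have h := orthonormal_iff_ite.1 b.orthonormal i j
  rw [PiLp.inner_apply] at h
  simpa [Matrix.mul_apply, Matrix.star_eq_conjTranspose, Matrix.one_apply, mul_comm] using h

/-- Right singular vectors are eigenvectors of `T* T`; left ones are their normalized images where
`σ > 0`, completed to an orthonormal basis. -/
theorem exists_isSVD (F : Matrix (Fin m) (Fin n) ℂ) : ∃ V W, IsSVD F V W := by
  classical
  set T := toLin F with hT
  set σ : ℕ → ℝ := ⇑T.singularValues with hσ
  have hsymm := T.isSymmetric_adjoint_comp_self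
  have hn : Module.finrank ℂ (EuclideanSpace ℂ (Fin n)) = n := finrank_euclideanSpace_fin
  set w := hsymm.eigenvectorBasis hn with hw
  have hinner : ∀ i j, inner ℂ (T (w i)) (T (w j)) = if i = j then ((σ j ^ 2 : ℝ) : ℂ) else 0 := by
    intro i j
    have h1 := hsymm.apply_eigenvectorBasis hn j
    rw [LinearMap.comp_apply] at h1
    rw [← LinearMap.adjoint_inner_right, h1, inner_smul_right, ← hw,
      orthonormal_iff_ite.1 w.orthonormal, hσ, T.sq_singularValues_fin hn]
    simp
  have hpos : ∀ i, 0 < σ i → i < m := by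
    intro i hi
    rw [hσ, T.singularValues_pos_iff_lt_finrank_range] at hi
    have := Submodule.finrank_le (LinearMap.range T)
    rw [finrank_euclideanSpace_fin] at this
    omega
  have hzero : ∀ j : Fin n, σ j = 0 → T (w j) = 0 := by
    intro j hj
    have := hinner j j
    rw [hj] at this
    simpa using this
  have hposn : ∀ i, 0 < σ i → i < n := by
    intro i hi
    by_contra h
    rw [hσ, T.singularValues_of_finrank_le (by rw [hn]; omega)] at hi
    exact lt_irrefl _ hi
  set v : Fin m → EuclideanSpace ℂ (Fin m) := fun i =>
    if h : (i : ℕ) < n then ((σ i : ℂ)⁻¹) • T (w ⟨i, h⟩) else 0 with hv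
  have hort : Orthonormal ℂ (Set.domRestrict {i : Fin m | 0 < σ i} v) := by
    rw [orthonormal_iff_ite]
    rintro ⟨i, hi⟩ ⟨j, hj⟩
    have hi' : (σ i : ℂ) ≠ 0 := by exact_mod_cast (ne_of_gt hi)
    simp only [Set.domRestrict_apply, hv, hposn _ hi, hposn _ hj, dif_pos, inner_smul_left,
      inner_smul_right, hinner, Subtype.mk.injEq, Fin.mk.injEq, Fin.val_inj]
    split_ifs with hij
    · subst hij
      simp only [map_inv₀, Complex.conj_ofReal]
      push_cast
      field_simp
    · simp
  obtain ⟨b, hb⟩ := hort.exists_orthonormalBasis_extension_of_card_eq (by simp)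
  refine ⟨_, _, of_orthonormalBasis_mem_unitaryGroup b,
    of_orthonormalBasis_mem_unitaryGroup w, ?_⟩
  have hW := Matrix.mem_unitaryGroup_iff.1 (of_orthonormalBasis_mem_unitaryGroup w)
  rw [Matrix.star_eq_conjTranspose] at hW
  set W : Matrix (Fin n) (Fin n) ℂ := Matrix.of fun p i => w i p with hWdef
  suffices h : F * W = (Matrix.of fun p i => b i p) * sigmaMatrix F by
    rw [← h, Matrix.mul_assoc, hW, Matrix.mul_one]
  ext p j
  have h1 : (F * W) p j = T (w j) p := by
    simp [hT, hWdef, toLin, Matrix.toLpLin_apply, Matrix.mul_apply, Matrix.mulVec, dotProduct]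
  rw [h1, Matrix.mul_apply]
  simp only [Matrix.of_apply, sigmaMatrix, singularValue, Nat.add_sub_cancel]
  by_cases hj : (j : ℕ) < m
  · rw [Finset.sum_eq_single ⟨j, hj⟩]
    · simp only [if_true]
      change _ = b ⟨j, hj⟩ p * (σ j : ℂ)
      rcases (T.singularValues_nonneg j).eq_or_lt with h0 | h0
      · rw [hzero j h0.symm, hσ, ← h0]
        simp
      · rw [hb ⟨j, hj⟩ h0]
        have : (σ j : ℂ) ≠ 0 := by exact_mod_cast (ne_of_gt h0)
        simp only [hv, j.2, dif_pos, PiLp.smul_apply, smul_eq_mul]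
        field_simp
    · intro x _ hx
      rw [if_neg (fun h' => hx (Fin.ext h')), mul_zero]
    · simp
  · rw [Finset.sum_eq_zero]
    · rw [hzero j]
      · simp
      · rcases (T.singularValues_nonneg j).eq_or_lt with h0 | h0
        · exact h0.symm
        · exact absurd (hpos _ h0) hj
    · intro x _
      rw [if_neg (by omega), mul_zero]

lemma singularValue_succ (F : Matrix (Fin m) (Fin n) ℂ) (i : ℕ) :
    singularValue F (i + 1) = (toLin F).singularValues i := rfl

lemma singularValue_succ_antitone (F : Matrix (Fin m) (Fin n) ℂ) :
    Antitone fun i => singularValue F (i + 1) :=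
  (toLin F).singularValues_antitone

lemma singularValue_nonneg (F : Matrix (Fin m) (Fin n) ℂ) (i : ℕ) : 0 ≤ singularValue F i :=
  (toLin F).singularValues_nonneg _

lemma singularValue_succ_eq_zero_iff (F : Matrix (Fin m) (Fin n) ℂ) (i : ℕ) :
    singularValue F (i + 1) = 0 ↔ F.rank ≤ i := by
  rw [singularValue_succ, LinearMap.singularValues_eq_zero_iff_le_finrank_range,
    finrank_range_toLin]

lemma rank_le_min (F : Matrix (Fin m) (Fin n) ℂ) : F.rank ≤ min m n :=
  le_min F.rank_le_height F.rank_le_width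

lemma sigmaMatrix_eq (F : Matrix (Fin m) (Fin n) ℂ) :
    sigmaMatrix F = rectDiagonal m n (fun i => ((singularValue F (i + 1) : ℝ) : ℂ)) := rfl

lemma blockId_eq (m n k : ℕ) :
    blockId m n k = rectDiagonal m n (fun i => ((if i < k then 1 else 0 : ℝ) : ℂ)) := by
  ext i j
  simp only [blockId, rectDiagonal, Matrix.of_apply]
  split_ifs <;> first | omega | simp

lemma sum_range_ite_mul {l : ℕ} (hk : k ≤ l) (t : ℕ → ℝ) :
    ∑ i ∈ range l, (if i < k then 1 else 0) * t i = ∑ i ∈ range k, t i := by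
  simp only [ite_mul, one_mul, zero_mul]
  rw [← sum_filter]
  congr 1
  ext i
  simp only [mem_filter, mem_range]
  omega

/-! ### The trace inequality and truncated decompositions -/

section Unitary

variable {V : Matrix (Fin m) (Fin m) ℂ} {W : Matrix (Fin n) (Fin n) ℂ}

lemma mul_unitary_injective (hV : V ∈ Matrix.unitaryGroup (Fin m) ℂ)
    (hW : W ∈ Matrix.unitaryGroup (Fin n) ℂ) :
    Function.Injective fun A : Matrix (Fin m) (Fin n) ℂ => V * A * Wᴴ := by
  have hV' : Vᴴ * V = 1 := Matrix.mem_unitaryGroup_iff'.1 hV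
  have hW' : Wᴴ * W = 1 := Matrix.mem_unitaryGroup_iff'.1 hW
  refine Function.LeftInverse.injective (g := fun A => Vᴴ * A * W) fun A => ?_
  simp only [Matrix.mul_assoc]
  rw [hW', Matrix.mul_one, ← Matrix.mul_assoc, hV', Matrix.one_mul]

lemma unitary_mul_cancel (hV : V ∈ Matrix.unitaryGroup (Fin m) ℂ)
    (hW : W ∈ Matrix.unitaryGroup (Fin n) ℂ) (Z : Matrix (Fin m) (Fin n) ℂ) :
    V * (Vᴴ * Z * W) * Wᴴ = Z := by
  have hV' : V * Vᴴ = 1 := Matrix.mem_unitaryGroup_iff.1 hV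
  have hW' : W * Wᴴ = 1 := Matrix.mem_unitaryGroup_iff.1 hW
  simp only [Matrix.mul_assoc]
  rw [hW', Matrix.mul_one, ← Matrix.mul_assoc, hV', Matrix.one_mul]

lemma frobRe_rectDiagonal_left (s : ℕ → ℝ) (B : Matrix (Fin m) (Fin n) ℂ) :
    frobRe (rectDiagonal m n fun i => (s i : ℂ)) B =
      ∑ i ∈ range (min m n), s i * (diagEntry B i).re := by
  rw [frobRe, trace_rectDiagonal_conjTranspose_mul, Complex.re_sum]
  exact sum_congr rfl fun i _ => by simp

lemma frobRe_sandwich (hV : V ∈ Matrix.unitaryGroup (Fin m) ℂ)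
    (hW : W ∈ Matrix.unitaryGroup (Fin n) ℂ) (a : ℕ → ℂ) (s : ℕ → ℝ) :
    frobRe (V * rectDiagonal m n a * Wᴴ) (V * (rectDiagonal m n fun i => (s i : ℂ)) * Wᴴ) =
      ∑ i ∈ range (min m n), (a i).re * s i := by
  rw [frobRe_mul_unitary hV hW, frobRe_comm, frobRe_rectDiagonal_left]
  exact sum_congr rfl fun i hi => by
    rw [rectDiagonal_apply_self _ (mem_range.1 hi), mul_comm]

lemma IsRankPartialIsometry.frobRe_le {Z : Matrix (Fin m) (Fin n) ℂ}
    (h : IsRankPartialIsometry k Z) (hk : k ≤ min m n)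
    (hV : V ∈ Matrix.unitaryGroup (Fin m) ℂ) (hW : W ∈ Matrix.unitaryGroup (Fin n) ℂ)
    {s : ℕ → ℝ} (hs : Antitone s) (hs0 : ∀ i, 0 ≤ s i) :
    frobRe Z (V * (rectDiagonal m n fun i => (s i : ℂ)) * Wᴴ) ≤ ∑ i ∈ range k, s i := by
  have hV' : star V ∈ Matrix.unitaryGroup (Fin m) ℂ := Unitary.star_mem hV
  have hW' : star W ∈ Matrix.unitaryGroup (Fin n) ℂ := Unitary.star_mem hW
  have hY := h.mul_unitary hV' hW'
  rw [Matrix.star_eq_conjTranspose, Matrix.star_eq_conjTranspose,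
    Matrix.conjTranspose_conjTranspose] at hY
  rw [← unitary_mul_cancel hV hW Z, frobRe_mul_unitary hV hW, frobRe_comm,
    frobRe_rectDiagonal_left]
  exact hY.sum_mul_re_diagEntry_le hk hs hs0

/-- A maximizer which is diagonal in a singular value decomposition. -/
lemma isMaximizer_rectDiagonal (hk : k ≤ min m n)
    (hV : V ∈ Matrix.unitaryGroup (Fin m) ℂ) (hW : W ∈ Matrix.unitaryGroup (Fin n) ℂ)
    {s : ℕ → ℝ} (hs : Antitone s) (hs0 : ∀ i, 0 ≤ s i) {a : ℕ → ℂ}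
    (ha : ∀ i, a i * star (a i) * a i = a i)
    (hak : ∑ i ∈ range (min m n), star (a i) * a i = k)
    (has : ∑ i ∈ range (min m n), (a i).re * s i = ∑ i ∈ range k, s i) :
    IsMaximizer k (V * (rectDiagonal m n fun i => (s i : ℂ)) * Wᴴ)
      (V * rectDiagonal m n a * Wᴴ) := by
  refine ⟨(isRankPartialIsometry_rectDiagonal ha hak).mul_unitary hV hW, fun Z hZ => ?_⟩
  rw [frobRe_sandwich hV hW, has]
  exact hZ.frobRe_le hk hV hW hs hs0

lemma isRankPartialIsometry_blockId (hk : k ≤ min m n) :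
    IsRankPartialIsometry k (blockId m n k) := by
  rw [blockId_eq]
  refine isRankPartialIsometry_rectDiagonal (fun i => ?_) ?_
  · split_ifs <;> simp
  · have := sum_range_ite_mul hk (fun i => if i < k then 1 else 0)
    rw [sum_congr rfl fun i hi => if_pos (mem_range.1 hi)] at this
    simp only [sum_const, card_range, nsmul_eq_mul, mul_one] at this
    simp only [Complex.star_def, Complex.conj_ofReal]
    exact_mod_cast this

lemma frobRe_blockId (hk : k ≤ min m n)
    (hV : V ∈ Matrix.unitaryGroup (Fin m) ℂ) (hW : W ∈ Matrix.unitaryGroup (Fin n) ℂ)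
    (s : ℕ → ℝ) :
    frobRe (V * blockId m n k * Wᴴ) (V * (rectDiagonal m n fun i => (s i : ℂ)) * Wᴴ) =
      ∑ i ∈ range k, s i := by
  rw [blockId_eq, frobRe_sandwich hV hW, ← sum_range_ite_mul hk s]
  rfl

lemma isMaximizer_blockId (hk : k ≤ min m n)
    (hV : V ∈ Matrix.unitaryGroup (Fin m) ℂ) (hW : W ∈ Matrix.unitaryGroup (Fin n) ℂ)
    {s : ℕ → ℝ} (hs : Antitone s) (hs0 : ∀ i, 0 ≤ s i) :
    IsMaximizer k (V * (rectDiagonal m n fun i => (s i : ℂ)) * Wᴴ)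
      (V * blockId m n k * Wᴴ) := by
  refine ⟨(isRankPartialIsometry_blockId hk).mul_unitary hV hW, fun Z hZ => ?_⟩
  rw [frobRe_blockId hk hV hW]
  exact hZ.frobRe_le hk hV hW hs hs0

lemma IsSVD.isMaximizer {F : Matrix (Fin m) (Fin n) ℂ} (h : IsSVD F V W) (hk : k ≤ min m n) :
    IsMaximizer k F (V * blockId m n k * Wᴴ) := by
  conv => arg 2; rw [h.2.2, sigmaMatrix_eq]
  exact isMaximizer_blockId hk h.1 h.2.1 (singularValue_succ_antitone F)
    fun i => singularValue_nonneg F _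

/-- The diagonal of a singular value decomposition consists of the singular values. -/
lemma isSVD_of_antitone {s : ℕ → ℝ} (hs : Antitone s) (hs0 : ∀ i, 0 ≤ s i)
    (hV : V ∈ Matrix.unitaryGroup (Fin m) ℂ) (hW : W ∈ Matrix.unitaryGroup (Fin n) ℂ)
    {F : Matrix (Fin m) (Fin n) ℂ} (hF : F = V * (rectDiagonal m n fun i => (s i : ℂ)) * Wᴴ) :
    IsSVD F V W := by
  obtain ⟨V', W', h⟩ := exists_isSVD F
  have hF' := h.2.2
  rw [sigmaMatrix_eq] at hF'
  -- Each partial sum is the maximal pairing with `F` over partial isometries of rank `j`, hence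
  -- independent of the decomposition.
  have hsum : ∀ j ≤ min m n, ∑ i ∈ range j, s i = ∑ i ∈ range j, singularValue F (i + 1) := by
    intro j hj
    have h1 := (isMaximizer_blockId hj hV hW hs hs0)
    have h2 := h.isMaximizer hj
    rw [← hF] at h1
    have e1 := frobRe_blockId hj hV hW s
    have e2 := frobRe_blockId hj h.1 h.2.1 (fun i => singularValue F (i + 1))
    rw [← hF] at e1
    rw [← hF'] at e2
    rw [← e1, ← e2]
    exact le_antisymm (h2.2 _ h1.1) (h1.2 _ h2.1)
  refine ⟨hV, hW, ?_⟩
  rw [sigmaMatrix_eq]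
  conv_lhs => rw [hF]
  congr 2
  refine rectDiagonal_congr fun i hi => ?_
  have h1 := hsum (i + 1) hi
  rw [sum_range_succ, sum_range_succ, hsum i hi.le] at h1
  rw [add_left_cancel h1]

end Unitary

/-! ### Every maximizer is a truncated decomposition -/

/-- The equality case of Cauchy–Schwarz: `‖A - B‖² = 2k - 2 Re⟨A, B⟩`. -/
lemma IsRankPartialIsometry.eq_of_le_frobRe {A B : Matrix (Fin m) (Fin n) ℂ}
    (hA : IsRankPartialIsometry k A) (hB : IsRankPartialIsometry k B) (h : k ≤ frobRe A B) :
    A = B := by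
  rw [← sub_eq_zero]
  refine eq_zero_of_frobRe_self_nonpos ?_
  rw [frobRe_sub_self, hA.frobRe_self, hB.frobRe_self, frobRe_comm B A]
  linarith

/-- The indicator of `{0, …, k - 1}` lowered by `c` at `i` and raised by `e` at `j`. -/
def modifiedIndicator (k i j : ℕ) (c e : ℝ) (x : ℕ) : ℝ :=
  (if x < k then 1 else 0) - (if x = i then c else 0) + (if x = j then e else 0)

lemma sum_modifiedIndicator_mul {l i j : ℕ} (hk : k ≤ l) (hi : i < l) (hj : j < l) (c e : ℝ)
    (t : ℕ → ℝ) : ∑ x ∈ range l, modifiedIndicator k i j c e x * t x =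
      ∑ x ∈ range k, t x - c * t i + e * t j := by
  simp only [modifiedIndicator, add_mul, sub_mul, sum_add_distrib, sum_sub_distrib]
  rw [sum_range_ite_mul hk]
  simp [ite_mul, hi, hj]

lemma isRankPartialIsometry_rectDiagonal_real {a : ℕ → ℝ} (ha : ∀ i, a i * a i * a i = a i)
    (hk : ∑ i ∈ range (min m n), a i * a i = k) :
    IsRankPartialIsometry k (rectDiagonal m n fun i => (a i : ℂ)) := by
  refine isRankPartialIsometry_rectDiagonal (fun i => ?_) ?_
  · simp only [Complex.star_def, Complex.conj_ofReal]
    exact_mod_cast ha i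
  · simp only [Complex.star_def, Complex.conj_ofReal]
    exact_mod_cast hk

/-- Competitor with entry `1 - 2 = -1` at `i`, used to test the sign of the diagonal of `F`. -/
lemma isRankPartialIsometry_flip {i : ℕ} (hk : k ≤ min m n) (hi : i < k) :
    IsRankPartialIsometry k
      (rectDiagonal m n fun x => (modifiedIndicator k i i 2 0 x : ℂ)) := by
  have e : ∀ x, modifiedIndicator k i i 2 0 x * modifiedIndicator k i i 2 0 x =
      modifiedIndicator k i i 0 0 x := by
    intro x
    simp only [modifiedIndicator]
    split_ifs <;> first | omega | norm_num
  refine isRankPartialIsometry_rectDiagonal_real (fun x => ?_) ?_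
  · simp only [modifiedIndicator]
    split_ifs <;> first | omega | norm_num
  · simp only [e]
    have := sum_modifiedIndicator_mul hk (hi.trans_le hk) (hi.trans_le hk) 0 0 (fun _ => 1)
    simpa using this

/-- Competitor using direction `j` in place of `i`, used to test the order of the diagonal of `F`.
-/
lemma isRankPartialIsometry_swap {i j : ℕ} (hk : k ≤ min m n) (hi : i < k) (hkj : k ≤ j)
    (hj : j < min m n) : IsRankPartialIsometry k
      (rectDiagonal m n fun x => (modifiedIndicator k i j 1 1 x : ℂ)) := by
  have e : ∀ x, modifiedIndicator k i j 1 1 x * modifiedIndicator k i j 1 1 x =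
      modifiedIndicator k i j 1 1 x := by
    intro x
    simp only [modifiedIndicator]
    split_ifs <;> first | omega | norm_num
  refine isRankPartialIsometry_rectDiagonal_real (fun x => ?_) ?_
  · rw [e, e]
  · simp only [e]
    have := sum_modifiedIndicator_mul hk (hi.trans_le hk) hj 1 1 (fun _ => 1)
    simpa using this

/-- Every maximizer is the truncation of the identity in some singular value decomposition. -/
theorem IsMaximizer.exists_isSVD {F X : Matrix (Fin m) (Fin n) ℂ} (hk : k ≤ min m n)
    (h : IsMaximizer k F X) : ∃ V W, IsSVD F V W ∧ X = V * blockId m n k * Wᴴ := by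
  obtain ⟨V, W, hsvd⟩ := FrameApprox.exists_isSVD (F + X)
  have hB := hsvd.isMaximizer hk
  have hX : X = V * blockId m n k * Wᴴ := by
    refine (hB.1.eq_of_le_frobRe h.1 ?_).symm
    have h1 := hB.2 X h.1
    have h2 := h.2 _ hB.1
    rw [frobRe_add, frobRe_add, h.1.frobRe_self] at h1
    linarith
  refine ⟨V, W, ?_, hX⟩
  obtain ⟨hV, hW, hS⟩ := hsvd
  set S : ℕ → ℝ := fun i => singularValue (F + X) (i + 1) with hSdef
  have hSa : Antitone S := singularValue_succ_antitone _
  have hS0 : ∀ i, 0 ≤ S i := fun i => singularValue_nonneg _ _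
  set d : ℕ → ℝ := fun i => S i - if i < k then 1 else 0 with hd
  have hF : F = V * (rectDiagonal m n fun i => (d i : ℂ)) * Wᴴ := by
    have e : (rectDiagonal m n fun i => (d i : ℂ)) + blockId m n k = sigmaMatrix (F + X) := by
      rw [blockId_eq, rectDiagonal_add, sigmaMatrix_eq]
      congr 1
      ext i
      simp [hd, hSdef]
    rw [← e, Matrix.mul_add, Matrix.add_mul, ← hX] at hS
    exact add_right_cancel hS
  have hval : ∀ ε : ℕ → ℝ, IsRankPartialIsometry k (rectDiagonal m n fun i => (ε i : ℂ)) →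
      ∑ i ∈ range (min m n), ε i * d i ≤ ∑ i ∈ range k, d i := by
    intro ε hε
    have h1 := h.2 _ (hε.mul_unitary hV hW)
    have h2 := frobRe_blockId hk hV hW d
    have h3 := frobRe_sandwich hV hW (fun i => (ε i : ℂ)) d
    rw [← hF, ← hX] at h2
    rw [← hF] at h3
    rw [h2, h3] at h1
    simpa using h1
  have hd0 : ∀ i < k, 0 ≤ d i := by
    intro i hi
    have h1 := hval _ (isRankPartialIsometry_flip hk hi)
    rw [sum_modifiedIndicator_mul hk (hi.trans_le hk) (hi.trans_le hk)] at h1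
    linarith
  have hdk : ∀ i, k ≤ i → d i = S i := fun i hi => by simp [hd, not_lt.2 hi]
  have hdlt : ∀ i < k, ∀ j, k ≤ j → d j ≤ d i := by
    intro i hi j hj
    by_cases hjl : j < min m n
    · have h1 := hval _ (isRankPartialIsometry_swap hk hi hj hjl)
      rw [sum_modifiedIndicator_mul hk (hi.trans_le hk) hjl] at h1
      linarith
    -- Beyond `min m n` there is no direction to swap in, but there the singular values vanish.
    · rw [hdk j hj, hSdef]
      have h0 := (singularValue_succ_eq_zero_iff (F + X) j).2
        ((rank_le_min _).trans (not_lt.1 hjl))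
      simp only [h0]
      exact hd0 i hi
  refine isSVD_of_antitone (s := d) (fun i j hij => ?_) (fun i => ?_) hV hW hF
  · by_cases hi : i < k
    · by_cases hj : j < k
      · simp only [hd, hi, hj, if_true]
        linarith [hSa hij]
      · exact hdlt i hi j (not_lt.1 hj)
    · rw [hdk i (not_lt.1 hi), hdk j (by omega)]
      exact hSa hij
  · by_cases hi : i < k
    · exact hd0 i hi
    · rw [hdk i (not_lt.1 hi)]
      exact hS0 i

/-! ### Uniqueness and its failure -/

/-- A gap between the `k`-th and the next singular value forces uniqueness. -/
theorem IsMaximizer.eq_of_gap {F X V W} (hk1 : 1 ≤ k) (hk : k ≤ min m n)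
    (hsvd : IsSVD (m := m) (n := n) F V W)
    (hgap : singularValue F (k + 1) < singularValue F k) (h : IsMaximizer k F X) :
    X = V * blockId m n k * Wᴴ := by
  have hB := hsvd.isMaximizer hk
  refine h.1.eq_of_le_frobRe hB.1 ?_
  obtain ⟨hV, hW, hS⟩ := hsvd
  set s : ℕ → ℝ := fun i => singularValue F (i + 1) with hs
  have hsa : Antitone s := singularValue_succ_antitone _
  have hs0 : ∀ i, 0 ≤ s i := fun i => singularValue_nonneg _ _
  have hgap' : s k < s (k - 1) := by
    simp only [hs, Nat.sub_add_cancel hk1]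
    exact hgap
  set δ := s (k - 1) - s k with hδ
  have hδ0 : 0 < δ := sub_pos.2 hgap'
  -- Lowering the first `k` singular values by exactly the gap keeps the sequence nonincreasing and
  -- nonnegative.
  set t : ℕ → ℝ := fun i => s i - if i < k then δ else 0 with ht
  have hta : Antitone t := by
    intro i j hij
    have h0 := hsa hij
    simp only [ht]
    split_ifs with hj hi hi
    · linarith
    · omega
    · have h1 : s j ≤ s k := hsa (not_lt.1 hj)
      have h2 : s (k - 1) ≤ s i := hsa (by omega)
      linarith
    · linarith
  have ht0 : ∀ i, 0 ≤ t i := by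
    intro i
    simp only [ht]
    split_ifs with hi
    · have h2 : s (k - 1) ≤ s i := hsa (by omega)
      linarith [hs0 k]
    · linarith [hs0 i]
  have hdec : F = V * (rectDiagonal m n fun i => (t i : ℂ)) * Wᴴ +
      (δ : ℂ) • (V * blockId m n k * Wᴴ) := by
    rw [← Matrix.smul_mul, ← Matrix.mul_smul, ← Matrix.add_mul, ← Matrix.mul_add]
    have e : (rectDiagonal m n fun i => (t i : ℂ)) + (δ : ℂ) • blockId m n k =
        sigmaMatrix F := by
      rw [sigmaMatrix_eq, blockId_eq]
      ext i j
      simp only [rectDiagonal, Matrix.of_apply, Matrix.add_apply, Matrix.smul_apply, ht, hs]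
      split_ifs <;> simp
    rw [e]
    exact hS
  have h1 := h.1.frobRe_le hk hV hW hta ht0
  have h2 := h.2 _ hB.1
  have h3 := frobRe_blockId hk hV hW s
  have hS' : F = V * (rectDiagonal m n fun i => (s i : ℂ)) * Wᴴ := hS
  rw [← hS'] at h3
  have h4 : frobRe X F = frobRe X (V * (rectDiagonal m n fun i => (t i : ℂ)) * Wᴴ) +
      δ * frobRe X (V * blockId m n k * Wᴴ) := by
    conv_lhs => rw [hdec]
    rw [frobRe_add]
    simp [frobRe]
  have h5 : ∑ i ∈ range k, t i = ∑ i ∈ range k, s i - k * δ := by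
    simp only [ht, sum_sub_distrib]
    rw [sum_congr rfl fun i hi => if_pos (mem_range.1 hi)]
    simp
  have h6 : δ * k ≤ δ * frobRe X (V * blockId m n k * Wᴴ) := by linarith
  exact le_of_mul_le_mul_left h6 hδ0

/-- Without a gap, exchanging two singular directions gives a second maximizer. -/
theorem exists_isMaximizer_ne {F : Matrix (Fin m) (Fin n) ℂ} (hk1 : 1 ≤ k) (hk : k < min m n)
    (heq : singularValue F k = singularValue F (k + 1)) :
    ∃ X Y, IsMaximizer k F X ∧ IsMaximizer k F Y ∧ X ≠ Y := by
  obtain ⟨V, W, hsvd⟩ := exists_isSVD F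
  have hB := hsvd.isMaximizer hk.le
  obtain ⟨hV, hW, hS⟩ := hsvd
  have hP := isRankPartialIsometry_swap (m := m) (n := n) (i := k - 1) (j := k) hk.le (by omega)
    le_rfl hk
  refine ⟨_, _, hB, ⟨hP.mul_unitary hV hW, fun Z hZ => ?_⟩, fun h => ?_⟩
  · refine (hB.2 Z hZ).trans (le_of_eq ?_)
    have h3 := frobRe_blockId hk.le hV hW (fun i => singularValue F (i + 1))
    have h4 := frobRe_sandwich hV hW (fun x => (modifiedIndicator k (k - 1) k 1 1 x : ℂ))
      (fun i => singularValue F (i + 1))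
    rw [← sigmaMatrix_eq, ← hS] at h3 h4
    rw [h3, h4]
    simp only [Complex.ofReal_re]
    rw [sum_modifiedIndicator_mul hk.le (by omega) hk, Nat.sub_add_cancel hk1, heq]
    ring
  · have h1 := mul_unitary_injective hV hW h
    have h2 := congrArg (fun A => diagEntry A k) h1
    simp only [blockId_eq, rectDiagonal_apply_self _ hk] at h2
    have hne : k ≠ k - 1 := by omega
    simp [modifiedIndicator, hne] at h2

/-- When the `k`-th singular value vanishes, one singular direction can be rotated freely. -/
theorem infinite_isMaximizer {F : Matrix (Fin m) (Fin n) ℂ} (hk1 : 1 ≤ k) (hk : k ≤ min m n)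
    (h0 : singularValue F k = 0) : {X | IsMaximizer k F X}.Infinite := by
  have : Infinite (Set.Ioc (-Real.pi) Real.pi) :=
    (Set.Ioc_infinite (by linarith [Real.pi_pos])).to_subtype
  have : Infinite Circle := Infinite.of_injective _ Circle.argEquiv.symm.injective
  obtain ⟨V, W, hV, hW, hS⟩ := exists_isSVD F
  -- The phase `z` sits at index `k - 1`, where it multiplies `s_k = 0` and leaves the pairing
  -- unchanged.
  set a : Circle → ℕ → ℂ := fun z i => if i < k then (if i = k - 1 then (z : ℂ) else 1) else 0
    with ha
  have hz : ∀ z : Circle, (starRingEnd ℂ) (z : ℂ) * z = 1 := fun z => by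
    rw [Complex.conj_mul', Circle.norm_coe]
    norm_num
  have hmax : ∀ z, IsMaximizer k F (V * rectDiagonal m n (a z) * Wᴴ) := by
    intro z
    have haa : ∀ i, star (a z i) * a z i = ((if i < k then 1 else 0 : ℝ) : ℂ) := by
      intro i
      simp only [ha]
      split_ifs <;> simp [hz]
    have := isMaximizer_rectDiagonal (m := m) (n := n) (a := a z) hk hV hW
      (singularValue_succ_antitone F) (fun i => singularValue_nonneg F _) (fun i => ?_) ?_ ?_
    · rw [← sigmaMatrix_eq, ← hS] at this
      exact this
    · rw [mul_assoc, haa]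
      simp only [ha]
      split_ifs <;> simp
    · have h1 := sum_range_ite_mul hk (fun _ => 1)
      simp only [mul_one, sum_const, card_range, nsmul_eq_mul] at h1
      simp only [haa]
      exact_mod_cast h1
    · rw [← sum_range_ite_mul hk]
      refine sum_congr rfl fun i _ => ?_
      simp only [ha]
      split_ifs with h1 h2
      · rw [h2, Nat.sub_add_cancel hk1, h0, mul_zero, mul_zero]
      · simp
      · simp
  refine Set.infinite_of_injective_forall_mem (f := fun z => V * rectDiagonal m n (a z) * Wᴴ)
    (fun z z' hzz => ?_) hmax
  have h2 := congrArg (fun A => diagEntry A (k - 1)) (mul_unitary_injective hV hW hzz)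
  simp only [rectDiagonal_apply_self _ (show k - 1 < min m n by omega)] at h2
  simp only [ha, show k - 1 < k by omega, if_true] at h2
  exact Circle.ext h2

/-! ### The canonical polar decomposition -/

lemma sandwich_mul {l p : ℕ} {W : Matrix (Fin n) (Fin n) ℂ}
    (hW : W ∈ Matrix.unitaryGroup (Fin n) ℂ) (V : Matrix (Fin m) (Fin m) ℂ)
    (Y : Matrix (Fin l) (Fin p) ℂ) (A : Matrix (Fin m) (Fin n) ℂ)
    (B : Matrix (Fin n) (Fin l) ℂ) : V * A * Wᴴ * (W * B * Y) = V * (A * B) * Y := by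
  have hW' : Wᴴ * W = 1 := Matrix.mem_unitaryGroup_iff'.1 hW
  simp only [Matrix.mul_assoc]
  rw [← Matrix.mul_assoc Wᴴ, hW', Matrix.one_mul]

open scoped ComplexOrder in
lemma IsSVD.matrixAbs_eq {F : Matrix (Fin m) (Fin n) ℂ} {V W} (h : IsSVD F V W) :
    matrixAbs F =
      W * (rectDiagonal n n fun i => ((singularValue F (i + 1) : ℝ) : ℂ)) * Wᴴ := by
  obtain ⟨hV, hW, hS⟩ := h
  refine CFC.sqrt_unique ?_ ?_
  · have e : Fᴴ = W * (sigmaMatrix F)ᴴ * Vᴴ := by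
      conv_lhs => rw [hS]
      simp only [Matrix.conjTranspose_mul, Matrix.conjTranspose_conjTranspose, Matrix.mul_assoc]
    have e2 : Fᴴ * F = W * (sigmaMatrix F)ᴴ * Vᴴ * (V * sigmaMatrix F * Wᴴ) := by
      rw [← e, ← hS]
    rw [e2, sandwich_mul hW, sandwich_mul hV, sigmaMatrix_eq, rectDiagonal_conjTranspose,
      rectDiagonal_mul, rectDiagonal_mul]
    congr 2
    refine rectDiagonal_congr fun i hi => ?_
    rw [min_self] at hi
    simp only [hi, if_true, Complex.star_def, Complex.conj_ofReal]
    split_ifs with him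
    · rfl
    · rw [(singularValue_succ_eq_zero_iff F i).2 ((rank_le_min F).trans (by omega))]
      simp
  · refine Matrix.PosSemidef.nonneg ?_
    refine Matrix.PosSemidef.mul_mul_conjTranspose_same ?_ W
    have e : (rectDiagonal n n fun i => ((singularValue F (i + 1) : ℝ) : ℂ)) =
        Matrix.diagonal fun i : Fin n => ((singularValue F (i + 1) : ℝ) : ℂ) := by
      ext i j
      by_cases hij : i = j
      · simp [rectDiagonal, hij]
      · simp [rectDiagonal, hij, Fin.val_inj]
    rw [e]
    refine Matrix.PosSemidef.diagonal fun i => ?_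
    exact Complex.zero_le_real.2 (singularValue_nonneg F _)

lemma ker_toLin_le_of_eq_mul {l : ℕ} {A : Matrix (Fin m) (Fin n) ℂ} {B : Matrix (Fin l) (Fin n) ℂ}
    {C : Matrix (Fin l) (Fin m) ℂ} (h : B = C * A) :
    LinearMap.ker (toLin A) ≤ LinearMap.ker (toLin B) := by
  intro x hx
  rw [LinearMap.mem_ker] at hx ⊢
  rw [h, toLin_mul_apply, hx, map_zero]

lemma mul_eq_zero_of_ker_le {l : ℕ} {A B : Matrix (Fin m) (Fin n) ℂ}
    {M : Matrix (Fin n) (Fin l) ℂ} (h : LinearMap.ker (toLin A) ≤ LinearMap.ker (toLin B))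
    (hA : A * M = 0) : B * M = 0 := by
  refine (Matrix.toEuclideanLin (𝕜 := ℂ)).injective ?_
  rw [map_zero]
  ext1 x
  have h1 : toLin M x ∈ LinearMap.ker (toLin A) := by
    rw [LinearMap.mem_ker, ← toLin_mul_apply, hA, toLin, map_zero, LinearMap.zero_apply]
  have h2 := h h1
  rw [LinearMap.mem_ker, ← toLin_mul_apply] at h2
  exact h2

/-- For `x` orthogonal to the kernel, `x - Xᴴ X x` lies in both the kernel and its complement, so it
is zero. -/
lemma isPartialIsometry_of_mul_conjTranspose_mul {X : Matrix (Fin m) (Fin n) ℂ}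
    (h : X * Xᴴ * X = X) : IsPartialIsometry X := by
  intro x hx
  have h1 : x - toLin (Xᴴ * X) x ∈ LinearMap.ker (toLin X) := by
    rw [LinearMap.mem_ker, map_sub, ← toLin_mul_apply, ← Matrix.mul_assoc, h, sub_self]
  have h2 : x - toLin (Xᴴ * X) x ∈ (LinearMap.ker (toLin X))ᗮ := by
    refine Submodule.sub_mem _ hx ?_
    rw [Submodule.mem_orthogonal]
    intro y hy
    rw [inner_toLin_right, Matrix.conjTranspose_mul, Matrix.conjTranspose_conjTranspose,
      toLin_mul_apply, LinearMap.mem_ker.1 hy, map_zero, inner_zero_left]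
  have h3 : x - toLin (Xᴴ * X) x = 0 := by
    have := Submodule.inner_right_of_mem_orthogonal h1 h2
    exact inner_self_eq_zero.1 this
  have h4 := norm_toLin_sq X x
  rw [← sub_eq_zero.1 h3, inner_self_eq_norm_sq_to_K] at h4
  have h5 : ‖toLin X x‖ ^ 2 = ‖x‖ ^ 2 := Complex.ofReal_injective (by simpa using h4)
  exact (sq_eq_sq₀ (norm_nonneg _) (norm_nonneg _)).1 h5

/-- The canonical polar decomposition in terms of a singular value decomposition. -/
theorem IsSVD.isCanonicalPolar_iff {F U : Matrix (Fin m) (Fin n) ℂ} {V W} (h : IsSVD F V W) :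
    IsCanonicalPolar F U ↔ U = V * blockId m n F.rank * Wᴴ := by
  have habs := h.matrixAbs_eq
  have hr := rank_le_min F
  have hmax := h.isMaximizer hr
  obtain ⟨hV, hW, hS⟩ := h
  set s : ℕ → ℂ := fun i => ((singularValue F (i + 1) : ℝ) : ℂ) with hs
  have hsig : sigmaMatrix F = rectDiagonal m n s := rfl
  have hs0 : ∀ i, s i = 0 ↔ F.rank ≤ i := fun i => by
    rw [← singularValue_succ_eq_zero_iff F i, hs, Complex.ofReal_eq_zero]
  set X := V * blockId m n F.rank * Wᴴ with hX
  have hFX : F = X * matrixAbs F := by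
    rw [habs, hX, sandwich_mul hW]
    conv_lhs => rw [hS]
    rw [hsig, blockId_eq, rectDiagonal_mul]
    congr 2
    refine rectDiagonal_congr fun i hi => ?_
    rw [if_pos (by omega)]
    by_cases hir : i < F.rank
    · simp [hir]
    · rw [if_neg hir, (hs0 i).2 (by omega), mul_zero]
  -- The convention `0⁻¹ = 0` makes this a pseudoinverse. With `hFX'`, each of `X` and `F` is a left
  -- multiple of the other, so their kernels agree.
  have hXF : X = V * (rectDiagonal m m fun i => (s i)⁻¹) * Vᴴ * F := by
    conv_rhs => rw [hS]
    rw [sandwich_mul hV, hsig, rectDiagonal_mul, hX, blockId_eq]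
    congr 2
    refine rectDiagonal_congr fun i hi => ?_
    rw [if_pos (show i < m by omega)]
    by_cases hir : i < F.rank
    · have : s i ≠ 0 := fun h => absurd ((hs0 i).1 h) (by omega)
      rw [if_pos hir, inv_mul_cancel₀ this, Complex.ofReal_one]
    · rw [if_neg hir, (hs0 i).2 (by omega), mul_zero, Complex.ofReal_zero]
  have hFX' : F = V * rectDiagonal m m s * Vᴴ * X := by
    rw [hX, sandwich_mul hV]
    conv_lhs => rw [hS]
    rw [hsig, blockId_eq, rectDiagonal_mul]
    congr 2
    refine rectDiagonal_congr fun i hi => ?_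
    rw [if_pos (by omega)]
    by_cases hir : i < F.rank
    · simp [hir]
    · rw [(hs0 i).2 (by omega), zero_mul]
  have hker : LinearMap.ker (toLin X) = LinearMap.ker (toLin F) :=
    le_antisymm (ker_toLin_le_of_eq_mul hFX') (ker_toLin_le_of_eq_mul hXF)
  refine ⟨fun hU => ?_, fun hU => ?_⟩
  · obtain ⟨-, hUker, hUF⟩ := hU
    -- `N` is the pseudoinverse of `|F|`. Since `U`, `X` and `F` have the same kernel, `U = U |F| N
    -- = F N = X |F| N = X`.
    set N := W * (rectDiagonal n n fun i => (s i)⁻¹) * Wᴴ with hN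
    have hFN : F * (1 - matrixAbs F * N) = 0 := by
      rw [Matrix.mul_sub, Matrix.mul_one, habs, hN, sandwich_mul hW, sub_eq_zero]
      conv_rhs => rw [hS]
      conv_lhs => rw [hS]
      rw [sandwich_mul hW, hsig, rectDiagonal_mul, rectDiagonal_mul]
      congr 2
      refine rectDiagonal_congr fun i hi => ?_
      rw [if_pos (by omega), if_pos (by omega)]
      by_cases hi0 : s i = 0
      · rw [hi0, zero_mul]
      · rw [mul_inv_cancel₀ hi0, mul_one]
    have h1 := mul_eq_zero_of_ker_le hUker.ge hFN
    have h2 := mul_eq_zero_of_ker_le hker.ge hFN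
    rw [Matrix.mul_sub, Matrix.mul_one, ← Matrix.mul_assoc, sub_eq_zero] at h1 h2
    rw [← hUF] at h1
    rw [← hFX] at h2
    rw [h1, h2]
  · rw [hU]
    exact ⟨isPartialIsometry_of_mul_conjTranspose_mul hmax.1.1, hker, hFX⟩

lemma isCanonicalParsevalFrame_columnFamily_iff (F X : Matrix (Fin m) (Fin n) ℂ) :
    IsCanonicalParsevalFrame (columnFamily F) (columnFamily X) ↔ IsCanonicalPolar F X := by
  rw [IsCanonicalParsevalFrame, synthesisMatrix_columnFamily]
  constructor
  · rintro ⟨U, hU, h⟩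
    rwa [columnFamily_injective h]
  · exact fun h => ⟨X, h, rfl⟩

end FrameApprox

end

/-! ### Translation back to frames -/

theorem mainTheorem5 (m n k : ℕ) (hk : 1 ≤ k) (hkq : k ≤ min m n)
    (K : Submodule ℂ (EuclideanSpace ℂ (Fin m))) (f : Fin n → EuclideanSpace ℂ (Fin m))
    (hf : FrameApprox.IsFrameFor f K) (F : Matrix (Fin m) (Fin n) ℂ)
    (hF : F = FrameApprox.synthesisMatrix f) (r : ℕ) (hr : F.rank = r) :
    (∀ u : Fin n → EuclideanSpace ℂ (Fin m),
      FrameApprox.IsSymmetricApprox f (FrameApprox.parsevalFramesOfExcess m n (n - k)) u ↔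
        ∃ (V : Matrix (Fin m) (Fin m) ℂ) (W : Matrix (Fin n) (Fin n) ℂ),
          FrameApprox.IsSVD F V W ∧
            u = FrameApprox.columnFamily (V * FrameApprox.blockId m n k * Wᴴ)) ∧
    (k < r →
      ((∃! u : Fin n → EuclideanSpace ℂ (Fin m),
          FrameApprox.IsSymmetricApprox f (FrameApprox.parsevalFramesOfExcess m n (n - k)) u) ↔
        FrameApprox.singularValue F k ≠ FrameApprox.singularValue F (k + 1))) ∧
    (k = r →
      (∃! u : Fin n → EuclideanSpace ℂ (Fin m),
        FrameApprox.IsSymmetricApprox f (FrameApprox.parsevalFramesOfExcess m n (n - k)) u) ∧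
      ∀ u : Fin n → EuclideanSpace ℂ (Fin m),
        FrameApprox.IsSymmetricApprox f (FrameApprox.parsevalFramesOfExcess m n (n - k)) u ↔
          FrameApprox.IsCanonicalParsevalFrame f u) ∧
    (r < k →
      {u : Fin n → EuclideanSpace ℂ (Fin m) |
        FrameApprox.IsSymmetricApprox f
          (FrameApprox.parsevalFramesOfExcess m n (n - k)) u}.Infinite) := by
  open FrameApprox in
  have hkn : k ≤ n := hkq.trans (min_le_right _ _)
  obtain rfl : f = columnFamily F := by rw [hF, columnFamily_synthesisMatrix]
  have hiff := fun X => isSymmetricApprox_columnFamily_iff hkn F X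
  have hsurj : ∀ u : Fin n → EuclideanSpace ℂ (Fin m), ∃ X, u = columnFamily X :=
    fun u => ⟨_, (columnFamily_synthesisMatrix u).symm⟩
  obtain ⟨V, W, hsvd⟩ := exists_isSVD F
  have hB := hsvd.isMaximizer hkq
  have hunique : singularValue F (k + 1) < singularValue F k →
      ∀ X, IsMaximizer k F X ↔ X = V * blockId m n k * Wᴴ := fun hgap X =>
    ⟨fun hX => hX.eq_of_gap hk hkq hsvd hgap, fun hX => hX ▸ hB⟩
  have hexu : singularValue F (k + 1) < singularValue F k →
      ∃! u : Fin n → EuclideanSpace ℂ (Fin m),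
        IsSymmetricApprox (columnFamily F) (parsevalFramesOfExcess m n (n - k)) u := by
    intro hgap
    refine ⟨_, (hiff _).2 hB, fun u hu => ?_⟩
    obtain ⟨X, rfl⟩ := hsurj u
    rw [(hunique hgap X).1 ((hiff X).1 hu)]
  have hle : singularValue F (k + 1) ≤ singularValue F k := by
    have := singularValue_succ_antitone F (Nat.sub_le k 1)
    simpa only [Nat.sub_add_cancel hk] using this
  have hzero := singularValue_succ_eq_zero_iff F (k - 1)
  rw [Nat.sub_add_cancel hk] at hzero
  refine ⟨fun u => ?_, fun hkr => ⟨fun hu heq => ?_, fun hne => ?_⟩, fun hkr => ?_, fun hkr => ?_⟩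
  · obtain ⟨X, rfl⟩ := hsurj u
    rw [hiff]
    constructor
    · intro hX
      obtain ⟨V', W', h, rfl⟩ := hX.exists_isSVD hkq
      exact ⟨V', W', h, rfl⟩
    · rintro ⟨V', W', h, hX⟩
      rw [columnFamily_injective hX]
      exact h.isMaximizer hkq
  · obtain ⟨X, Y, hX, hY, hXY⟩ := exists_isMaximizer_ne hk
      (hkr.trans_le (hr ▸ rank_le_min F)) heq
    exact hXY (columnFamily_injective (hu.unique ((hiff X).2 hX) ((hiff Y).2 hY)))
  · exact hexu (lt_of_le_of_ne hle hne.symm)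
  -- For `k = r` the gap is automatic: `s_{r+1} = 0 < s_r`.
  · have hgap : singularValue F (k + 1) < singularValue F k := by
      rw [(singularValue_succ_eq_zero_iff F k).2 (by omega)]
      exact lt_of_le_of_ne (singularValue_nonneg F k) fun h => by
        have := hzero.1 h.symm
        omega
    refine ⟨hexu hgap, fun u => ?_⟩
    obtain ⟨X, rfl⟩ := hsurj u
    rw [hiff, isCanonicalParsevalFrame_columnFamily_iff, hsvd.isCanonicalPolar_iff, hunique hgap,
      hr, hkr]
  · have := infinite_isMaximizer hk hkq (hzero.2 (by omega))
    refine (this.image columnFamily_injective.injOn).mono ?_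
    rintro _ ⟨X, hX, rfl⟩
    exact (hiff X).2 hX
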